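/- Let $J\subseteq\mathbb R$ be an interval, let $g$ be a real function that is locally Lipschitz on $J$, let $\alpha\in\mathbb R$ and let $\lambda,\beta\in J$ with $0\le\lambda<\beta$. Suppose that $g(x)<0$ for all $x\in(\lambda,\beta]$ and $g(\lambda)=0$. Then the boundary value problem $$f'''+f f''+g(f')=0 \text{ on } [0,\infty),\qquad f(0)=\alpha,\qquad f'(0)=\beta,\qquad \lim_{t\to\infty}f'(t)=\lambda$$ has exactly one concave solution, that is, there is exactly one concave, three times differentiable function $f:[0,\infty)\to\mathbb R$ (derivatives at $0$ being one-sided) that satisfies it. -/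

import Mathlib

open Set Filter Topology

/-- `f` (only its restriction to `[0, ∞)` matters) is a solution on `[0, ∞)` of
`f''' + f f'' + g(f') = 0`, `f 0 = α`, `f' 0 = β`, `f' t → l` as `t → ∞`.
The functions `f₁, f₂, f₃` are the first three derivatives of `f` on `[0, ∞)`
(one-sided at `0`); they are determined by `f` there. -/
def IsSolutionBVP (g : ℝ → ℝ) (α β l : ℝ) (f : ℝ → ℝ) : Prop :=
  ∃ f₁ f₂ f₃ : ℝ → ℝ,
    (∀ t ∈ Ici (0 : ℝ), HasDerivWithinAt f (f₁ t) (Ici 0) t) ∧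
    (∀ t ∈ Ici (0 : ℝ), HasDerivWithinAt f₁ (f₂ t) (Ici 0) t) ∧
    (∀ t ∈ Ici (0 : ℝ), HasDerivWithinAt f₂ (f₃ t) (Ici 0) t) ∧
    (∀ t ∈ Ici (0 : ℝ), f₃ t + f t * f₂ t + g (f₁ t) = 0) ∧
    f 0 = α ∧ f₁ 0 = β ∧ Tendsto f₁ atTop (𝓝 l)

/-- A concave solution of the boundary value problem. Its derivative decreases from `β` to `l`,
so it takes values in `[l, β]` and only the values of `g` on `[l, β]` are used. -/
def IsConcaveSolutionBVP (g : ℝ → ℝ) (α β l : ℝ) (f : ℝ → ℝ) : Prop :=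
  IsSolutionBVP g α β l f ∧ ConcaveOn ℝ (Ici 0) f

/-! Put y = f', z = f'' and w = z + f y. The equation becomes f' = y, y' = w - f y, w' = y² - g(y).
Once y and g are cut off outside the slopes that matter, f and w grow at most linearly, so every
initial value has a global trajectory that depends continuously on it.

Existence is by shooting in w(0), with f(0) = α and y(0) = β. While y > λ, z can only vanish with z'
= -g(y) > 0, so z then becomes positive. If y reaches λ with z ≤ 0, then z < 0, since z = 0 would
put the trajectory on the ray y = λ for all earlier times; so y crosses λ. Both exits are open
conditions on w(0), they are disjoint, and each occurs. As ℝ is connected, some trajectory keeps y >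
λ and z < 0 forever (`exists_shearFlow_stays`). Its slope tends to λ: if y stayed above some a > λ ≥
0, f would eventually be nonnegative and z' = -f z - g(y) would be bounded below by a positive
constant, making z positive.

For uniqueness take the slope x as independent variable (Crocco): F is the value and U = -f'', with
F' = -x/U and U' = F - g/U. As x ≥ 0 and g < 0, a gap U₁ - U₂ > 0 at x = β only widens as x
decreases (`CroccoPair.sub_le_sub`). Then f'' would stay below a negative constant, which is absurd.
So f''(0) is determined, and with it f. -/

/-! ### Shear coordinates: a priori bounds and uniqueness -/

/-- The autonomous vector field `(f, y, w) ↦ (κ y, w - f * κ y, q y)`. -/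
def shearField (κ q : ℝ → ℝ) (x : ℝ × ℝ × ℝ) : ℝ × ℝ × ℝ :=
  (κ x.2.1, x.2.2 - x.1 * κ x.2.1, q x.2.1)

/-- `X` is an integral curve of `shearField κ q` on `s`. -/
def IsShearFlow (κ q : ℝ → ℝ) (X : ℝ → ℝ × ℝ × ℝ) (s : Set ℝ) : Prop :=
  ∀ t ∈ s, HasDerivWithinAt X (shearField κ q (X t)) s t

/-- The product f κ(y) is the only term that is not globally Lipschitz; as κ is bounded, a bound on
f is enough. -/
theorem exists_lipschitzOnWith_shearField {κ q : ℝ → ℝ} {K₁ K₂ : NNReal} {B : ℝ}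
    (hκ : LipschitzWith K₁ κ) (hq : LipschitzWith K₂ q) (hB : ∀ y, |κ y| ≤ B) (R : ℝ) :
    ∃ K : NNReal, LipschitzOnWith K (shearField κ q) {x | |x.1| ≤ R} := by
  have hB0 : 0 ≤ B := (abs_nonneg _).trans (hB 0)
  refine ⟨Real.toNNReal (1 + B + |R| * K₁ + K₁ + K₂), LipschitzOnWith.of_dist_le_mul ?_⟩
  rintro ⟨f, y, w⟩ hx ⟨f', y', w'⟩ -
  rw [Real.coe_toNNReal _ (by positivity)]
  simp only [mem_ofPred_eq] at hx
  simp only [shearField, Prod.dist_eq, Real.dist_eq]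
  set d := max |f - f'| (max |y - y'| |w - w'|) with hd
  have h1 : |f - f'| ≤ d := le_max_left _ _
  have h2 : |y - y'| ≤ d := (le_max_left _ _).trans (le_max_right _ _)
  have h3 : |w - w'| ≤ d := (le_max_right _ _).trans (le_max_right _ _)
  have hd0 : 0 ≤ d := (abs_nonneg _).trans h1
  have hK₁ : |κ y - κ y'| ≤ K₁ * d :=
    (hκ.dist_le_mul y y').trans (mul_le_mul_of_nonneg_left h2 K₁.2)
  have hK₂ : |q y - q y'| ≤ K₂ * d :=
    (hq.dist_le_mul y y').trans (mul_le_mul_of_nonneg_left h2 K₂.2)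
  have e1 : 0 ≤ B * d := by positivity
  have e2 : 0 ≤ |R| * (K₁ * d) := by positivity
  have e3 : 0 ≤ K₁ * d := by positivity
  have e4 : 0 ≤ K₂ * d := by positivity
  refine max_le ?_ (max_le ?_ ?_)
  · nlinarith
  · have p1 : |f * (κ y - κ y')| ≤ |R| * (K₁ * d) := by
      rw [abs_mul]
      exact mul_le_mul (hx.trans (le_abs_self R)) hK₁ (abs_nonneg _) (abs_nonneg _)
    have p2 : |(f - f') * κ y'| ≤ d * B := by
      rw [abs_mul]
      exact mul_le_mul h1 (hB _) (abs_nonneg _) hd0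
    have : w - f * κ y - (w' - f' * κ y')
        = (w - w') - (f * (κ y - κ y') + (f - f') * κ y') := by ring
    rw [this]
    have := abs_sub (w - w') (f * (κ y - κ y') + (f - f') * κ y')
    have := abs_add_le (f * (κ y - κ y')) ((f - f') * κ y')
    nlinarith
  · nlinarith

theorem abs_le_of_hasDerivWithinAt_Icc {u u' : ℝ → ℝ} {B T : ℝ}
    (h : ∀ t ∈ Icc 0 T, HasDerivWithinAt u (u' t) (Icc 0 T) t) (hB : ∀ t, |u' t| ≤ B) :
    ∀ t ∈ Icc 0 T, |u t| ≤ |u 0| + B * t := by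
  intro t ht
  have := (convex_Icc (0 : ℝ) T).norm_image_sub_le_of_norm_hasDerivWithin_le (C := B) h
    (fun t _ => hB t) (left_mem_Icc.2 (ht.1.trans ht.2)) ht
  rw [Real.norm_eq_abs, Real.norm_eq_abs, sub_zero, abs_of_nonneg ht.1] at this
  have h2 := abs_sub_abs_le_abs_sub (u t) (u 0)
  linarith

theorem HasDerivWithinAt.prod_components {E F : Type*} [NormedAddCommGroup E] [NormedSpace ℝ E]
    [NormedAddCommGroup F] [NormedSpace ℝ F] {X : ℝ → E × F} {v : E × F} {s : Set ℝ} {t : ℝ}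
    (h : HasDerivWithinAt X v s t) :
    HasDerivWithinAt (fun t => (X t).1) v.1 s t ∧ HasDerivWithinAt (fun t => (X t).2) v.2 s t :=
  ⟨hasFDerivAt_fst (𝕜 := ℝ) (p := X t) |>.comp_hasDerivWithinAt t h,
    hasFDerivAt_snd (𝕜 := ℝ) (p := X t) |>.comp_hasDerivWithinAt t h⟩

theorem HasDerivWithinAt.shear_components {X : ℝ → ℝ × ℝ × ℝ} {v : ℝ × ℝ × ℝ} {s : Set ℝ} {t : ℝ}
    (h : HasDerivWithinAt X v s t) :
    HasDerivWithinAt (fun t => (X t).1) v.1 s t ∧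
    HasDerivWithinAt (fun t => (X t).2.1) v.2.1 s t ∧
    HasDerivWithinAt (fun t => (X t).2.2) v.2.2 s t :=
  ⟨h.prod_components.1, h.prod_components.2.prod_components⟩

theorem IsShearFlow.mono {κ q : ℝ → ℝ} {X : ℝ → ℝ × ℝ × ℝ} {s s' : Set ℝ}
    (h : IsShearFlow κ q X s) (hs : s' ⊆ s) : IsShearFlow κ q X s' :=
  fun t ht => (h t (hs ht)).mono hs

theorem IsShearFlow.continuousOn {κ q : ℝ → ℝ} {X : ℝ → ℝ × ℝ × ℝ} {s : Set ℝ}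
    (h : IsShearFlow κ q X s) : ContinuousOn X s :=
  fun t ht => (h t ht).continuousWithinAt

theorem IsShearFlow.abs_fst_le {κ q : ℝ → ℝ} {X : ℝ → ℝ × ℝ × ℝ} {B T : ℝ}
    (h : IsShearFlow κ q X (Icc 0 T)) (hB : ∀ y, |κ y| ≤ B) :
    ∀ t ∈ Icc 0 T, |(X t).1| ≤ |(X 0).1| + B * t :=
  abs_le_of_hasDerivWithinAt_Icc (fun t ht => (h t ht).shear_components.1) (fun _ => hB _)

theorem IsShearFlow.abs_fst_le_const {κ q : ℝ → ℝ} {X : ℝ → ℝ × ℝ × ℝ} {B T : ℝ}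
    (h : IsShearFlow κ q X (Icc 0 T)) (hB : ∀ y, |κ y| ≤ B) {A : ℝ} (hA : |(X 0).1| ≤ A) :
    ∀ t ∈ Icc 0 T, |(X t).1| ≤ A + B * T := by
  intro t ht
  have h1 := h.abs_fst_le hB t ht
  have := mul_le_mul_of_nonneg_left ht.2 ((abs_nonneg _).trans (hB 0))
  linarith

theorem IsShearFlow.hasDerivWithinAt_Ici {κ q : ℝ → ℝ} {X : ℝ → ℝ × ℝ × ℝ} {T : ℝ}
    (h : IsShearFlow κ q X (Icc 0 T)) {t : ℝ} (ht : t ∈ Ico 0 T) :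
    HasDerivWithinAt X (shearField κ q (X t)) (Ici t) t :=
  (h t ⟨ht.1, ht.2.le⟩).mono_of_mem_nhdsWithin
    (mem_of_superset (Icc_mem_nhdsGE ht.2) (Icc_subset_Icc_left ht.1))

theorem IsShearFlow.hasDerivWithinAt_Iic {κ q : ℝ → ℝ} {X : ℝ → ℝ × ℝ × ℝ} {T : ℝ}
    (h : IsShearFlow κ q X (Icc 0 T)) {t : ℝ} (ht : t ∈ Ioc 0 T) :
    HasDerivWithinAt X (shearField κ q (X t)) (Iic t) t :=
  (h t ⟨ht.1.le, ht.2⟩).mono_of_mem_nhdsWithin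
    (mem_of_superset (Icc_mem_nhdsLE ht.1) (Icc_subset_Icc_right ht.2))

/-- Continuous dependence on the initial value, uniformly on `[0, T]`. -/
theorem IsShearFlow.exists_dist_le {κ q : ℝ → ℝ} {K₁ K₂ : NNReal} {B : ℝ}
    (hκ : LipschitzWith K₁ κ) (hq : LipschitzWith K₂ q) (hB : ∀ y, |κ y| ≤ B) (A T : ℝ) :
    ∃ M : ℝ, ∀ X Y : ℝ → ℝ × ℝ × ℝ, IsShearFlow κ q X (Icc 0 T) → IsShearFlow κ q Y (Icc 0 T) →
      |(X 0).1| ≤ A → |(Y 0).1| ≤ A →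
      ∀ t ∈ Icc 0 T, dist (X t) (Y t) ≤ dist (X 0) (Y 0) * M := by
  obtain ⟨K, hK⟩ := exists_lipschitzOnWith_shearField hκ hq hB (A + B * T)
  refine ⟨Real.exp (K * T), fun X Y hX hY hXA hYA t ht => ?_⟩
  have := dist_le_of_trajectories_ODE_of_mem (v := fun _ => shearField κ q)
    (s := fun _ => {x | |x.1| ≤ A + B * T}) (a := 0) (b := T) (fun _ _ => hK)
    hX.continuousOn (fun t ht => hX.hasDerivWithinAt_Ici ht)
    (fun t ht => hX.abs_fst_le_const hB hXA t (Ico_subset_Icc_self ht))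
    hY.continuousOn (fun t ht => hY.hasDerivWithinAt_Ici ht)
    (fun t ht => hY.abs_fst_le_const hB hYA t (Ico_subset_Icc_self ht)) le_rfl t ht
  refine this.trans ?_
  gcongr
  linarith [ht.2]

theorem IsShearFlow.eqOn {κ q : ℝ → ℝ} {K₁ K₂ : NNReal} {B T : ℝ}
    (hκ : LipschitzWith K₁ κ) (hq : LipschitzWith K₂ q) (hB : ∀ y, |κ y| ≤ B)
    {X Y : ℝ → ℝ × ℝ × ℝ} (hX : IsShearFlow κ q X (Icc 0 T)) (hY : IsShearFlow κ q Y (Icc 0 T))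
    (h0 : X 0 = Y 0) : EqOn X Y (Icc 0 T) := by
  obtain ⟨M, hM⟩ := IsShearFlow.exists_dist_le hκ hq hB (|(X 0).1|) T
  intro t ht
  have := hM X Y hX hY le_rfl (by rw [h0]) t ht
  rw [h0, dist_self, zero_mul] at this
  exact dist_le_zero.1 this

/-- Backward uniqueness, needed to rule out reaching the ray of slope l in finite time. -/
theorem IsShearFlow.eqOn_of_right {κ q : ℝ → ℝ} {K₁ K₂ : NNReal} {B T : ℝ}
    (hκ : LipschitzWith K₁ κ) (hq : LipschitzWith K₂ q) (hB : ∀ y, |κ y| ≤ B)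
    {X Y : ℝ → ℝ × ℝ × ℝ} (hX : IsShearFlow κ q X (Icc 0 T)) (hY : IsShearFlow κ q Y (Icc 0 T))
    (hT : X T = Y T) : EqOn X Y (Icc 0 T) := by
  set A := max |(X 0).1| |(Y 0).1|
  obtain ⟨K, hK⟩ := exists_lipschitzOnWith_shearField hκ hq hB (A + B * T)
  exact ODE_solution_unique_of_mem_Icc_left (v := fun _ => shearField κ q)
    (s := fun _ => {x | |x.1| ≤ A + B * T}) (a := 0) (b := T) (fun _ _ => hK)
    hX.continuousOn (fun t ht => hX.hasDerivWithinAt_Iic ht)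
    (fun t ht => hX.abs_fst_le_const hB (le_max_left _ _) t (Ioc_subset_Icc_self ht))
    hY.continuousOn (fun t ht => hY.hasDerivWithinAt_Iic ht)
    (fun t ht => hY.abs_fst_le_const hB (le_max_right _ _) t (Ioc_subset_Icc_self ht)) hT

/-! ### Global existence of trajectories -/

theorem abs_max_neg_min_le {R : ℝ} (hR : 0 ≤ R) (a : ℝ) : |max (-R) (min R a)| ≤ R :=
  abs_le.2 ⟨le_max_left _ _, max_le (by linarith) (min_le_left _ _)⟩

theorem max_neg_min_eq_self {R a : ℝ} (ha : |a| ≤ R) : max (-R) (min R a) = a := by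
  rw [min_eq_right (abs_le.1 ha).2, max_eq_right (abs_le.1 ha).1]

theorem lipschitzWith_max_min (a b : ℝ) : LipschitzWith 1 (fun y : ℝ => max a (min b y)) :=
  (LipschitzWith.id.const_min b).const_max a

/-- Truncating f and w at bounds that they cannot exceed by time T makes the field bounded and
Lipschitz; on the Picard–Lindelöf solution the truncation is inactive. The slope needs none, since
it enters only through κ and q. -/
theorem exists_isShearFlow_Icc {κ q : ℝ → ℝ} {K₁ K₂ : NNReal} {B C : ℝ}
    (hκ : LipschitzWith K₁ κ) (hq : LipschitzWith K₂ q) (hB : ∀ y, |κ y| ≤ B)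
    (hC : ∀ y, |q y| ≤ C) (x₀ : ℝ × ℝ × ℝ) {T : ℝ} (hT : 0 ≤ T) :
    ∃ X : ℝ → ℝ × ℝ × ℝ, X 0 = x₀ ∧ IsShearFlow κ q X (Icc 0 T) := by
  have hB0 : 0 ≤ B := (abs_nonneg _).trans (hB 0)
  have hC0 : 0 ≤ C := (abs_nonneg _).trans (hC 0)
  set R := |x₀.1| + B * T with hR
  set W := |x₀.2.2| + C * T with hW
  have hR0 : 0 ≤ R := by positivity
  have hW0 : 0 ≤ W := by positivity
  let p : ℝ × ℝ × ℝ → ℝ × ℝ × ℝ := fun x =>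
    (max (-R) (min R x.1), x.2.1, max (-W) (min W x.2.2))
  have hp : LipschitzWith 1 p := by
    have h1 : LipschitzWith 1 (fun x : ℝ × ℝ × ℝ => max (-R) (min R x.1)) := by
      simpa using! (lipschitzWith_max_min (-R) R).comp LipschitzWith.prod_fst
    have h2 : LipschitzWith 1 (fun x : ℝ × ℝ × ℝ => x.2.1) := by
      simpa using! LipschitzWith.prod_fst.comp LipschitzWith.prod_snd
    have h3 : LipschitzWith 1 (fun x : ℝ × ℝ × ℝ => max (-W) (min W x.2.2)) := by
      simpa using! (lipschitzWith_max_min (-W) W).comp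
        (LipschitzWith.prod_snd.comp LipschitzWith.prod_snd)
    simpa using! h1.prodMk (h2.prodMk h3)
  have hpR : ∀ x, |(p x).1| ≤ R := fun x => abs_max_neg_min_le hR0 _
  have hpW : ∀ x, |(p x).2.2| ≤ W := fun x => abs_max_neg_min_le hW0 _
  obtain ⟨K, hK⟩ := exists_lipschitzOnWith_shearField hκ hq hB R
  have hlip : LipschitzWith K (fun x => shearField κ q (p x)) := by
    rw [← lipschitzOnWith_univ]
    simpa using! hK.comp (hp.lipschitzOnWith (s := univ)) (fun x _ => hpR x)
  set N : NNReal := Real.toNNReal (B + (W + R * B) + C)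
  have hN : (N : ℝ) = B + (W + R * B) + C := Real.coe_toNNReal _ (by positivity)
  have hbd : ∀ x, ‖shearField κ q (p x)‖ ≤ N := by
    intro x
    rw [hN]
    have e1 : |(p x).1 * κ (p x).2.1| ≤ R * B := by
      rw [abs_mul]
      exact mul_le_mul (hpR x) (hB _) (abs_nonneg _) hR0
    have e2 := abs_sub (p x).2.2 ((p x).1 * κ (p x).2.1)
    have e3 : 0 ≤ R * B := by positivity
    refine max_le ?_ (max_le ?_ ?_)
    · exact (hB _).trans (by linarith)
    · exact e2.trans (by linarith [hpW x])
    · exact (hC _).trans (by linarith)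
  have hPL : IsPicardLindelof (fun _ x => shearField κ q (p x))
      (⟨0, left_mem_Icc.2 hT⟩ : Icc (0 : ℝ) T) x₀ (N * Real.toNNReal T) 0 N K :=
    IsPicardLindelof.of_time_independent (fun x _ => hbd x) hlip.lipschitzOnWith (by
      simp [hT])
  obtain ⟨X, hX0, hX⟩ := hPL.exists_eq_forall_mem_Icc_hasDerivWithinAt₀
  simp only at hX0
  refine ⟨X, hX0, fun t ht => ?_⟩
  have h1 : |(X t).1| ≤ R := by
    have := abs_le_of_hasDerivWithinAt_Icc (u' := fun t => (shearField κ q (p (X t))).1)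
      (fun t ht => (hX t ht).shear_components.1) (fun _ => hB _) t ht
    rw [hX0] at this
    exact this.trans (by rw [hR]; gcongr; exact ht.2)
  have h2 : |(X t).2.2| ≤ W := by
    have := abs_le_of_hasDerivWithinAt_Icc (u' := fun t => (shearField κ q (p (X t))).2.2)
      (fun t ht => (hX t ht).shear_components.2.2) (fun _ => hC _) t ht
    rw [hX0] at this
    exact this.trans (by rw [hW]; gcongr; exact ht.2)
  have h3 : p (X t) = X t := by
    ext
    · exact max_neg_min_eq_self h1
    · rfl
    · exact max_neg_min_eq_self h2
  have := hX t ht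
  rwa [h3] at this

theorem exists_isShearFlow_Ici {κ q : ℝ → ℝ} {K₁ K₂ : NNReal} {B C : ℝ}
    (hκ : LipschitzWith K₁ κ) (hq : LipschitzWith K₂ q) (hB : ∀ y, |κ y| ≤ B)
    (hC : ∀ y, |q y| ≤ C) (x₀ : ℝ × ℝ × ℝ) :
    ∃ X : ℝ → ℝ × ℝ × ℝ, X 0 = x₀ ∧ IsShearFlow κ q X (Ici 0) := by
  choose Y hY0 hY using fun n : ℕ =>
    exists_isShearFlow_Icc hκ hq hB hC x₀ (T := n) n.cast_nonneg
  have key : ∀ m n : ℕ, ∀ t : ℝ, 0 ≤ t → t ≤ m → t ≤ n → Y m t = Y n t := by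
    intro m n t h0 hm hn
    exact ((hY m).mono (Icc_subset_Icc_right hm)).eqOn hκ hq hB
      ((hY n).mono (Icc_subset_Icc_right hn)) ((hY0 m).trans (hY0 n).symm) ⟨h0, le_rfl⟩
  have hX : ∀ m : ℕ, ∀ t : ℝ, 0 ≤ t → t ≤ m → Y (⌊t⌋₊ + 1) t = Y m t := fun m t h0 hm =>
    key _ _ t h0 (by push_cast; exact (Nat.lt_floor_add_one t).le) hm
  -- The index ⌊t⌋₊ + 1 keeps t strictly below the right end of the interval, so derivatives within
  -- it are derivatives within `Ici 0`.
  refine ⟨fun t => Y (⌊t⌋₊ + 1) t, by simp [hY0], fun t (ht : 0 ≤ t) => ?_⟩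
  have htm : t < ((⌊t⌋₊ + 1 : ℕ) : ℝ) := by push_cast; exact Nat.lt_floor_add_one t
  have hmem : Icc (0 : ℝ) ((⌊t⌋₊ + 1 : ℕ) : ℝ) ∈ 𝓝[Ici 0] t := by
    rw [← Ici_inter_Iic]
    exact inter_mem_nhdsWithin _ (Iic_mem_nhds htm)
  refine ((hY _ t ⟨ht, htm.le⟩).mono_of_mem_nhdsWithin hmem).congr_of_eventuallyEq ?_ rfl
  filter_upwards [hmem] with s hs using hX _ s hs.1 hs.2

/-! ### One-variable calculus -/

theorem monotoneOn_of_hasDerivWithinAt_subset {s D : Set ℝ} {u u' : ℝ → ℝ} (hD : Convex ℝ D)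
    (hs : D ⊆ s) (h : ∀ t ∈ D, HasDerivWithinAt u (u' t) s t) (h0 : ∀ t ∈ D, 0 ≤ u' t) :
    MonotoneOn u D :=
  monotoneOn_of_hasDerivWithinAt_nonneg hD (fun t ht => ((h t ht).mono hs).continuousWithinAt)
    (fun t ht => (h t (interior_subset ht)).mono (interior_subset.trans hs))
    (fun t ht => h0 t (interior_subset ht))

theorem antitoneOn_of_hasDerivWithinAt_subset {s D : Set ℝ} {u u' : ℝ → ℝ} (hD : Convex ℝ D)
    (hs : D ⊆ s) (h : ∀ t ∈ D, HasDerivWithinAt u (u' t) s t) (h0 : ∀ t ∈ D, u' t ≤ 0) :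
    AntitoneOn u D :=
  antitoneOn_of_hasDerivWithinAt_nonpos hD (fun t ht => ((h t ht).mono hs).continuousWithinAt)
    (fun t ht => (h t (interior_subset ht)).mono (interior_subset.trans hs))
    (fun t ht => h0 t (interior_subset ht))

theorem HasDerivWithinAt.eventually_lt_right {u : ℝ → ℝ} {u' t : ℝ}
    (h : HasDerivWithinAt u u' (Ici t) t) (h0 : 0 < u') : ∀ᶠ s in 𝓝[>] t, u t < u s := by
  have h1 := (hasDerivWithinAt_iff_tendsto_slope' self_notMem_Ioi).1 h.Ioi_of_Ici
  filter_upwards [h1.eventually (lt_mem_nhds h0), self_mem_nhdsWithin] with s hs (hts : t < s)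
  exact (slope_pos_iff_of_le hts.le).1 hs

/-- A property holding at `t` and slightly to the right of it holds on some `[t, t']` where
another property that holds frequently on the right of `t` is true at `t'`. -/
theorem exists_gt_forall_Icc {P Q : ℝ → Prop} {t : ℝ} (hP : ∀ᶠ s in 𝓝[≥] t, P s)
    (hQ : ∀ᶠ s in 𝓝[>] t, Q s) : ∃ t' > t, Q t' ∧ ∀ s ∈ Icc t t', P s := by
  obtain ⟨u, hu, hPu⟩ := mem_nhdsGE_iff_exists_Ico_subset.1 hP
  have hI : ∀ᶠ s in 𝓝[>] t, s ∈ Ioo t u := Ioo_mem_nhdsGT (mem_Ioi.1 hu)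
  obtain ⟨t', ht', hQ'⟩ := (hI.and hQ).exists
  exact ⟨t', ht'.1, hQ', fun s hs => hPu ⟨hs.1, hs.2.trans_lt ht'.2⟩⟩

/-! ### Cutting off the nonlinearity -/

/-- The clamp to `[l, b + 1]`. -/
def slopeClamp (l b y : ℝ) : ℝ := max l (min (b + 1) y)

/-- The right-hand side for `f'' + f f'`, with `g` cut off outside `[l, b]`. -/
def clampedGrowth (g : ℝ → ℝ) (l b y : ℝ) : ℝ := slopeClamp l b y ^ 2 - g (max l (min b y))

section clamp
variable {g : ℝ → ℝ} {l b : ℝ}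

theorem lipschitzWith_slopeClamp : LipschitzWith 1 (slopeClamp l b) :=
  lipschitzWith_max_min l (b + 1)

theorem slopeClamp_eq {y : ℝ} (h : y ∈ Icc l (b + 1)) : slopeClamp l b y = y := by
  rw [slopeClamp, min_eq_right h.2, max_eq_right h.1]

theorem clampedGrowth_eq {y : ℝ} (h : y ∈ Icc l b) : clampedGrowth g l b y = y ^ 2 - g y := by
  rw [clampedGrowth, slopeClamp_eq ⟨h.1, by linarith [h.2]⟩, min_eq_right h.2, max_eq_right h.1]

theorem abs_slopeClamp_le (hl : 0 ≤ l) (hlb : l < b) (y : ℝ) : |slopeClamp l b y| ≤ b + 1 := by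
  rw [slopeClamp, abs_of_nonneg (hl.trans (le_max_left _ _))]
  exact max_le (by linarith) (min_le_left _ _)

theorem max_min_mem_Icc (hlb : l < b) (y : ℝ) : max l (min b y) ∈ Icc l b :=
  ⟨le_max_left _ _, max_le hlb.le (min_le_left _ _)⟩

theorem exists_lipschitzWith_clampedGrowth {K : NNReal} (hg : LipschitzOnWith K g (Icc l b))
    (hl : 0 ≤ l) (hlb : l < b) : ∃ K₂, LipschitzWith K₂ (clampedGrowth g l b) := by
  have hb : 0 ≤ b := by linarith
  refine ⟨Real.toNNReal (2 * (b + 1) + K), LipschitzWith.of_dist_le_mul fun y y' => ?_⟩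
  rw [Real.coe_toNNReal _ (by positivity), Real.dist_eq, Real.dist_eq]
  have h1 : |g (max l (min b y)) - g (max l (min b y'))| ≤ K * |y - y'| := by
    have := hg.dist_le_mul _ (max_min_mem_Icc hlb y) _ (max_min_mem_Icc hlb y')
    refine this.trans (mul_le_mul_of_nonneg_left ?_ K.2)
    simpa using! (lipschitzWith_max_min l b).dist_le_mul y y'
  have h2 : |slopeClamp l b y - slopeClamp l b y'| ≤ |y - y'| := by
    simpa using! lipschitzWith_slopeClamp.dist_le_mul y y'
  have h3 : |slopeClamp l b y ^ 2 - slopeClamp l b y' ^ 2| ≤ 2 * (b + 1) * |y - y'| := by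
    rw [sq_sub_sq, abs_mul]
    refine mul_le_mul ?_ h2 (abs_nonneg _) (by positivity)
    refine (abs_add_le _ _).trans ?_
    linarith [abs_slopeClamp_le hl hlb y, abs_slopeClamp_le hl hlb y']
  have : clampedGrowth g l b y - clampedGrowth g l b y' =
      (slopeClamp l b y ^ 2 - slopeClamp l b y' ^ 2)
        - (g (max l (min b y)) - g (max l (min b y'))) := by
    simp only [clampedGrowth]; ring
  rw [this]
  refine (abs_sub _ _).trans ?_
  linarith

theorem exists_abs_clampedGrowth_le (hg : ContinuousOn g (Icc l b)) (hl : 0 ≤ l) (hlb : l < b) :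
    ∃ C, ∀ y, |clampedGrowth g l b y| ≤ C := by
  obtain ⟨C, hC⟩ := isCompact_Icc.exists_bound_of_continuousOn hg
  refine ⟨(b + 1) ^ 2 + C, fun y => (abs_sub _ _).trans ?_⟩
  have h1 := hC _ (max_min_mem_Icc hlb y)
  have h2 : |slopeClamp l b y ^ 2| ≤ (b + 1) ^ 2 := by
    rw [abs_pow]
    exact pow_le_pow_left₀ (abs_nonneg _) (abs_slopeClamp_le hl hlb y) 2
  rw [Real.norm_eq_abs] at h1
  linarith

end clamp

/-! ### Acceleration along a trajectory -/

/-- The second derivative `w - f * κ y` along a curve `(f, y, w)`. -/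
def shearAccel (κ : ℝ → ℝ) (X : ℝ → ℝ × ℝ × ℝ) (t : ℝ) : ℝ :=
  (X t).2.2 - (X t).1 * κ (X t).2.1

section flow
variable {g : ℝ → ℝ} {l b : ℝ} {X : ℝ → ℝ × ℝ × ℝ}

theorem IsShearFlow.continuousOn_slope {κ q : ℝ → ℝ} {s : Set ℝ} (h : IsShearFlow κ q X s) :
    ContinuousOn (fun t => (X t).2.1) s :=
  continuous_fst.comp_continuousOn (continuous_snd.comp_continuousOn h.continuousOn)

theorem IsShearFlow.continuousOn_accel {κ q : ℝ → ℝ} {s : Set ℝ} (hκ : Continuous κ)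
    (h : IsShearFlow κ q X s) : ContinuousOn (shearAccel κ X) s := by
  have : Continuous fun x : ℝ × ℝ × ℝ => x.2.2 - x.1 * κ x.2.1 := by fun_prop
  exact this.comp_continuousOn h.continuousOn

/-- Subtracting (f y)' = y² + f z from w' = y² - g(y) recovers the original equation z' = -f z -
g(y). -/
theorem IsShearFlow.hasDerivWithinAt_accel
    (h : IsShearFlow (slopeClamp l b) (clampedGrowth g l b) X (Ici 0)) {t : ℝ} (ht : 0 ≤ t)
    (h1 : l < (X t).2.1) (h2 : (X t).2.1 ≤ b) :
    HasDerivWithinAt (shearAccel (slopeClamp l b) X)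
      (-((X t).1 * shearAccel (slopeClamp l b) X t) - g (X t).2.1) (Ici 0) t := by
  obtain ⟨d1, d2, d3⟩ := (h t ht).shear_components
  -- The margin in b + 1 serves here: the slope may equal b, as it does at time 0, and the clamp
  -- must still be the identity at nearby times.
  have hev : ∀ᶠ s in 𝓝[Ici 0] t, (X s).2.1 ∈ Ioo l (b + 1) :=
    d2.continuousWithinAt.eventually (Ioo_mem_nhds h1 (by linarith))
  have hk : slopeClamp l b (X t).2.1 = (X t).2.1 := slopeClamp_eq ⟨h1.le, by linarith⟩
  have := (d3.sub (d1.mul d2)).congr_of_eventuallyEq (f₁ := shearAccel (slopeClamp l b) X) (by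
    filter_upwards [hev] with s hs
    simp only [shearAccel, Pi.sub_apply, Pi.mul_apply]
    rw [slopeClamp_eq ⟨hs.1.le, hs.2.le⟩]) (by
    simp only [shearAccel, Pi.sub_apply, Pi.mul_apply]; rw [hk])
  convert! this using 1
  simp only [shearField, shearAccel, hk, clampedGrowth_eq ⟨h1.le, h2⟩]
  ring

/-- The trajectory cannot come to rest at slope `l`. -/
theorem IsShearFlow.accel_ne_zero {K₁ K₂ : NNReal} {B : ℝ}
    (hκ : LipschitzWith K₁ (slopeClamp l b)) (hq : LipschitzWith K₂ (clampedGrowth g l b))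
    (hB : ∀ y, |slopeClamp l b y| ≤ B) (hlb : l < b) (hgl : g l = 0)
    (h : IsShearFlow (slopeClamp l b) (clampedGrowth g l b) X (Ici 0))
    (h0 : (X 0).2.1 = b) {T : ℝ} (hT : 0 ≤ T) (hyT : (X T).2.1 = l) :
    shearAccel (slopeClamp l b) X T ≠ 0 := by
  intro hz
  have hkl : slopeClamp l b l = l := slopeClamp_eq ⟨le_rfl, by linarith⟩
  -- The affine solution of slope l through X T; it solves the system because g l = 0. Backward
  -- uniqueness would force slope l at time 0.
  let Y : ℝ → ℝ × ℝ × ℝ := fun t =>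
    ((X T).1 + l * (t - T), l, l * ((X T).1 + l * (t - T)))
  have hY : IsShearFlow (slopeClamp l b) (clampedGrowth g l b) Y (Icc 0 T) := by
    intro t ht
    have e1 : HasDerivWithinAt (fun t => (X T).1 + l * (t - T)) l (Icc 0 T) t := by
      simpa using ((((hasDerivAt_id t).sub_const T).const_mul l).const_add (X T).1).hasDerivWithinAt
    convert! e1.prodMk ((hasDerivWithinAt_const t (Icc 0 T) l).prodMk (e1.const_mul l)) using 1
    simp only [Y, shearField, hkl, clampedGrowth_eq (⟨le_rfl, hlb.le⟩ : l ∈ Icc l b), hgl]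
    ext <;> simp <;> ring
  have hXY : X T = Y T := by
    simp only [shearAccel, hyT, hkl] at hz
    ext
    · simp [Y]
    · exact hyT
    · simp only [Y]; linarith
  have := (h.mono Icc_subset_Ici_self).eqOn_of_right hκ hq hB hY hXY (left_mem_Icc.2 hT)
  have h2 : (X 0).2.1 = l := by rw [this]
  linarith

end flow

/-! ### Dependence on the shooting parameter -/

section family
variable {κ q : ℝ → ℝ} {K₁ K₂ : NNReal} {B : ℝ} {X : ℝ → ℝ → ℝ × ℝ × ℝ}

/-- Joint continuity of a family of trajectories, frozen before time `0`. -/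
theorem continuous_uncurry_shearFlow (hκ : LipschitzWith K₁ κ) (hq : LipschitzWith K₂ q)
    (hB : ∀ y, |κ y| ≤ B) (hX : ∀ c, IsShearFlow κ q (X c) (Ici 0))
    (h0 : Continuous fun c => X c 0) :
    Continuous fun p : ℝ × ℝ => X p.1 (max p.2 0) := by
  rw [continuous_iff_continuousAt]
  rintro ⟨c₀, t₀⟩
  set T := max t₀ 0 + 1
  have h0' : Tendsto (fun p : ℝ × ℝ => X p.1 0) (𝓝 (c₀, t₀)) (𝓝 (X c₀ 0)) :=
    (h0.comp continuous_fst).tendsto (c₀, t₀)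
  obtain ⟨M, hM⟩ := IsShearFlow.exists_dist_le hκ hq hB (|(X c₀ 0).1| + 1) T
  have hc₀ : Continuous fun t => X c₀ (max t 0) :=
    (hX c₀).continuousOn.comp_continuous (by fun_prop) fun t => mem_Ici.2 (le_max_right _ _)
  have hlim : Tendsto (fun p : ℝ × ℝ => dist (X p.1 0) (X c₀ 0) * M
      + dist (X c₀ (max p.2 0)) (X c₀ (max t₀ 0))) (𝓝 (c₀, t₀)) (𝓝 0) := by
    have h1 := (h0'.dist (tendsto_const_nhds (x := X c₀ 0))).mul_const M
    have h2 : Tendsto (fun p : ℝ × ℝ => X c₀ (max p.2 0)) (𝓝 (c₀, t₀)) (𝓝 (X c₀ (max t₀ 0))) :=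
      (hc₀.comp continuous_snd).tendsto (c₀, t₀)
    simpa using h1.add (h2.dist (tendsto_const_nhds (x := X c₀ (max t₀ 0))))
  rw [ContinuousAt, tendsto_iff_dist_tendsto_zero]
  refine squeeze_zero' (Eventually.of_forall fun _ => dist_nonneg) ?_ hlim
  have hT : ∀ᶠ p : ℝ × ℝ in 𝓝 (c₀, t₀), max p.2 0 < T :=
    (by fun_prop : Continuous fun p : ℝ × ℝ => max p.2 0).continuousAt.eventually_lt
      continuousAt_const (by simp [T])
  have hA : ∀ᶠ p : ℝ × ℝ in 𝓝 (c₀, t₀), |(X p.1 0).1| < |(X c₀ 0).1| + 1 :=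
    ((continuous_fst.tendsto _).comp h0').abs.eventually (gt_mem_nhds (by simp))
  filter_upwards [hT, hA] with p hp hpA
  refine (dist_triangle _ (X c₀ (max p.2 0)) _).trans (add_le_add ?_ le_rfl)
  exact hM _ _ ((hX _).mono Icc_subset_Ici_self) ((hX _).mono Icc_subset_Ici_self)
    hpA.le (by simp) _ ⟨le_max_right _ _, hp.le⟩

/-- Joint continuity and compactness of [0, T] let the same T serve all nearby parameters. Both
exits have this form. -/
theorem isOpen_setOf_exists_forall_Icc (hκ : LipschitzWith K₁ κ) (hq : LipschitzWith K₂ q)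
    (hB : ∀ y, |κ y| ≤ B) (hX : ∀ c, IsShearFlow κ q (X c) (Ici 0))
    (h0 : Continuous fun c => X c 0) {U V : Set (ℝ × ℝ × ℝ)} (hU : IsOpen U) (hV : IsOpen V) :
    IsOpen {c | ∃ T, 0 ≤ T ∧ X c T ∈ V ∧ ∀ t ∈ Icc 0 T, X c t ∈ U} := by
  have hcont := continuous_uncurry_shearFlow hκ hq hB hX h0
  rw [isOpen_iff_mem_nhds]
  rintro c ⟨T, hT, hcV, hcU⟩
  have h1 : ∀ᶠ c' in 𝓝 c, X c' (max T 0) ∈ V :=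
    (hcont.comp (by fun_prop : Continuous fun c' : ℝ => (c', T))).continuousAt.eventually
      (hV.mem_nhds (by simpa [max_eq_left hT] using hcV))
  have h2 : ∀ᶠ c' in 𝓝 c, ∀ t ∈ Icc 0 T, X c' (max t 0) ∈ U := by
    refine isCompact_Icc.eventually_forall_of_forall_eventually fun t ht => ?_
    exact hcont.continuousAt.eventually
      (hU.mem_nhds (by simpa [max_eq_left ht.1] using hcU t ht))
  filter_upwards [h1, h2] with c' h1 h2
  rw [max_eq_left hT] at h1
  exact ⟨T, hT, h1, fun t ht => by simpa [max_eq_left ht.1] using h2 t ht⟩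

end family

/-! ### Shooting -/

section shooting
variable {g : ℝ → ℝ} {l b : ℝ} {K₁ K₂ : NNReal} {B : ℝ} {X : ℝ → ℝ × ℝ × ℝ}

theorem IsShearFlow.antitoneOn_slope {κ q : ℝ → ℝ} {T : ℝ} (h : IsShearFlow κ q X (Ici 0))
    (hz : ∀ t ∈ Icc 0 T, shearAccel κ X t ≤ 0) : AntitoneOn (fun t => (X t).2.1) (Icc 0 T) :=
  antitoneOn_of_hasDerivWithinAt_subset (convex_Icc 0 T) Icc_subset_Ici_self
    (fun t ht => (h t ht.1).shear_components.2.1) hz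

theorem continuousWithinAt_Ici_of_continuousOn {u : ℝ → ℝ} (h : ContinuousOn u (Ici 0)) {t : ℝ}
    (ht : 0 ≤ t) : ContinuousWithinAt u (Ici t) t :=
  (h t ht).mono (Ici_subset_Ici.2 ht)

/-- A trajectory starting at slope `b` either stays forever in the region of slope `> l` and
negative acceleration, or leaves it through exactly one of the two open exits. -/
theorem IsShearFlow.stays_or_exits
    (hκ : LipschitzWith K₁ (slopeClamp l b)) (hq : LipschitzWith K₂ (clampedGrowth g l b))
    (hB : ∀ y, |slopeClamp l b y| ≤ B) (hlb : l < b) (hgl : g l = 0)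
    (hneg : ∀ x ∈ Ioc l b, g x < 0)
    (h : IsShearFlow (slopeClamp l b) (clampedGrowth g l b) X (Ici 0)) (h0 : (X 0).2.1 = b) :
    (∀ t, 0 ≤ t → l < (X t).2.1 ∧ shearAccel (slopeClamp l b) X t < 0) ∨
    (∃ T, 0 ≤ T ∧ 0 < shearAccel (slopeClamp l b) X T ∧ ∀ t ∈ Icc 0 T, l < (X t).2.1) ∨
    (∃ T, 0 ≤ T ∧ (X T).2.1 < l ∧ ∀ t ∈ Icc 0 T, shearAccel (slopeClamp l b) X t < 0) := by
  have hyc := h.continuousOn_slope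
  have hzc := h.continuousOn_accel hκ.continuous
  set y := fun t => (X t).2.1 with hy
  set z := shearAccel (slopeClamp l b) X with hz
  by_contra! hcon
  obtain ⟨⟨t₁, ht₁, hbad⟩, hA, hBB⟩ := hcon
  -- Its infimum T is the first time at which the trajectory is no longer in the open region y > l,
  -- z < 0.
  set S := {t | t ∈ Ici (0 : ℝ) ∧ min (y t - l) (-z t) ≤ 0} with hS
  have hSc : IsClosed S :=
    ((hyc.sub continuousOn_const).inf hzc.neg).preimage_isClosed_of_isClosed isClosed_Ici isClosed_Iic
  have hSne : S.Nonempty := by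
    refine ⟨t₁, ht₁, ?_⟩
    rcases lt_or_ge l (y t₁) with h1 | h1
    · exact (min_le_right _ _).trans (by linarith [hbad h1])
    · exact (min_le_left _ _).trans (by linarith)
  have hSb : BddBelow S := ⟨0, fun t ht => ht.1⟩
  set T := sInf S
  obtain ⟨hT0, hTS⟩ : T ∈ S := hSc.csInf_mem hSne hSb
  replace hT0 : 0 ≤ T := hT0
  have hbefore : ∀ t, 0 ≤ t → t < T → l < y t ∧ z t < 0 := by
    intro t ht0 htT
    have : ¬ min (y t - l) (-z t) ≤ 0 := fun hmem => absurd (csInf_le hSb ⟨ht0, hmem⟩) (not_le.2 htT)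
    rw [not_le, lt_min_iff] at this
    exact ⟨by linarith, by linarith⟩
  rcases lt_or_ge l (y T) with hlT | hlT
  · have hall : ∀ t ∈ Icc 0 T, l < y t := fun t ht =>
      (eq_or_lt_of_le ht.2).elim (fun e => e ▸ hlT) fun hlt => (hbefore t ht.1 hlt).1
    have hzT0 : 0 ≤ z T := by
      rcases min_le_iff.1 hTS with h1 | h1 <;> linarith
    have hzT : z T = 0 := by
      refine le_antisymm (not_lt.1 fun hpos => ?_) hzT0
      obtain ⟨t, ht, hle⟩ := hA T hT0 hpos
      exact absurd (hall t ht) (not_lt.2 hle)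
    have hyb : y T ≤ b := by
      have hanti := h.antitoneOn_slope (T := T) fun t ht =>
        (eq_or_lt_of_le ht.2).elim (fun e => (e ▸ hzT : z t = 0).le)
          fun hlt => (hbefore t ht.1 hlt).2.le
      have := hanti (left_mem_Icc.2 hT0) (right_mem_Icc.2 hT0) hT0
      simpa [h0] using this
    -- At z = 0 the derivative of z is -g(y) > 0, so z is positive just after T while y is still
    -- above l: the first exit.
    have hd := (h.hasDerivWithinAt_accel hT0 hlT hyb).mono (Ici_subset_Ici.2 hT0)
    have hpos := hd.eventually_lt_right (by
      have := hneg (y T) ⟨hlT, hyb⟩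
      rw [← hz, hzT]; simp only [hy] at this; linarith)
    have hylt : ∀ᶠ s in 𝓝[≥] T, l < y s :=
      (continuousWithinAt_Ici_of_continuousOn hyc hT0).eventually (lt_mem_nhds hlT)
    obtain ⟨T', hT', hzT', hyT'⟩ := exists_gt_forall_Icc hylt hpos
    obtain ⟨t, ht, hle⟩ := hA T' (hT0.trans hT'.le) (by rw [← hz, hzT] at hzT'; exact hzT')
    rcases le_total t T with h1 | h1
    · exact absurd (hall t ⟨ht.1, h1⟩) (not_lt.2 hle)
    · exact absurd (hyT' t ⟨h1, ht.2⟩) (not_lt.2 hle)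
  · have hTpos : 0 < T := by
      refine lt_of_le_of_ne hT0 fun e => ?_
      rw [← e] at hlT
      simp only [hy, h0] at hlT
      linarith
    have hcl : T ∈ closure (Ico 0 T) := by
      rw [closure_Ico hTpos.ne]; exact right_mem_Icc.2 hT0
    have hsub : Ico 0 T ⊆ Ici 0 := fun t ht => ht.1
    have hyT : y T = l := le_antisymm hlT
      (ContinuousWithinAt.closure_le hcl continuousWithinAt_const ((hyc T hT0).mono hsub)
        fun t ht => (hbefore t ht.1 ht.2).1.le)
    have hzT : z T ≤ 0 :=
      ContinuousWithinAt.closure_le hcl ((hzc T hT0).mono hsub) continuousWithinAt_const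
        fun t ht => (hbefore t ht.1 ht.2).2.le
    have hzT' : z T < 0 := lt_of_le_of_ne hzT (h.accel_ne_zero hκ hq hB hlb hgl h0 hT0 hyT)
    have hd := ((h T hT0).shear_components.2.1.mono (Ici_subset_Ici.2 hT0)).neg
    have hpos := hd.eventually_lt_right (neg_pos.2 hzT')
    have hzlt : ∀ᶠ s in 𝓝[≥] T, z s < 0 :=
      (continuousWithinAt_Ici_of_continuousOn hzc hT0).eventually (gt_mem_nhds hzT')
    obtain ⟨T', hT', hyT', hzT''⟩ := exists_gt_forall_Icc hzlt hpos
    obtain ⟨t, ht, hle⟩ := hBB T' (hT0.trans hT'.le) (by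
      have h1 : -y T < -y T' := hyT'
      show y T' < l
      linarith)
    rcases lt_or_ge t T with h1 | h1
    · exact absurd (hbefore t ht.1 h1).2 (not_lt.2 hle)
    · exact absurd (hzT'' t ⟨h1, ht.2⟩) (not_lt.2 hle)

/-- Shooting with a very negative initial acceleration makes the slope cross `l`. -/
theorem exists_forall_shearFlow_exits {κ q : ℝ → ℝ} {C : ℝ} (hB : ∀ y, |κ y| ≤ B)
    (hC : ∀ y, |q y| ≤ C) (α b l : ℝ) :
    ∃ c : ℝ, ∀ X, IsShearFlow κ q X (Ici 0) → X 0 = (α, b, c) →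
      (X 1).2.1 < l ∧ ∀ t ∈ Icc 0 1, shearAccel κ X t < 0 := by
  have hB0 : 0 ≤ B := (abs_nonneg _).trans (hB 0)
  have hC0 : 0 ≤ C := (abs_nonneg _).trans (hC 0)
  set D := |b - l| + 1
  -- On [0, 1], w rises by at most C and |f κ(y)| ≤ (|α| + B) B, so z ≤ -D there; D > b - l carries
  -- the slope below l by time 1.
  refine ⟨-(C + (|α| + B) * B + D), fun X hX h0 => ?_⟩
  have hX' : IsShearFlow κ q X (Icc 0 1) := hX.mono Icc_subset_Ici_self
  have hacc : ∀ t ∈ Icc (0 : ℝ) 1, shearAccel κ X t ≤ -D := by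
    intro t ht
    have h1 := hX'.abs_fst_le_const hB (A := |α|) (by rw [h0]) t ht
    have h2 : (X t).2.2 ≤ (X 0).2.2 + C * t := by
      have := (convex_Icc (0 : ℝ) 1).norm_image_sub_le_of_norm_hasDerivWithin_le (C := C)
        (fun t ht => (hX' t ht).shear_components.2.2) (fun t _ => hC _)
        (left_mem_Icc.2 zero_le_one) ht
      rw [Real.norm_eq_abs, Real.norm_eq_abs, sub_zero, abs_of_nonneg ht.1] at this
      linarith [le_abs_self ((X t).2.2 - (X 0).2.2)]
    have h3 : |(X t).1 * κ (X t).2.1| ≤ (|α| + B * 1) * B := by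
      rw [abs_mul]
      exact mul_le_mul h1 (hB _) (abs_nonneg _) (by positivity)
    have h4 : C * t ≤ C := mul_le_of_le_one_right hC0 ht.2
    rw [h0] at h2
    simp only [shearAccel] at h2 ⊢
    linarith [neg_abs_le ((X t).1 * κ (X t).2.1)]
  have hD : 0 < D := by positivity
  refine ⟨?_, fun t ht => (hacc t ht).trans_lt (by linarith)⟩
  have hanti := antitoneOn_of_hasDerivWithinAt_subset (u := fun t => (X t).2.1 + D * t)
    (u' := fun t => shearAccel κ X t + D)
    (convex_Icc 0 1) (Icc_subset_Ici_self : Icc (0 : ℝ) 1 ⊆ Ici 0)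
    (fun t ht => by
      simpa using! (hX t ht.1).shear_components.2.1.add
        ((hasDerivAt_id t).const_mul D).hasDerivWithinAt)
    (fun t ht => by linarith [hacc t ht])
  have := hanti (left_mem_Icc.2 zero_le_one) (right_mem_Icc.2 zero_le_one) zero_le_one
  simp only [h0] at this
  linarith [le_abs_self (b - l)]

theorem exists_shearFlow_stays {C : ℝ}
    (hκ : LipschitzWith K₁ (slopeClamp l b)) (hq : LipschitzWith K₂ (clampedGrowth g l b))
    (hB : ∀ y, |slopeClamp l b y| ≤ B) (hC : ∀ y, |clampedGrowth g l b y| ≤ C)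
    (hlb : l < b) (hgl : g l = 0) (hneg : ∀ x ∈ Ioc l b, g x < 0) (α : ℝ) :
    ∃ X, IsShearFlow (slopeClamp l b) (clampedGrowth g l b) X (Ici 0) ∧
      (X 0).1 = α ∧ (X 0).2.1 = b ∧
      ∀ t, 0 ≤ t → l < (X t).2.1 ∧ shearAccel (slopeClamp l b) X t < 0 := by
  choose X hX0 hX using fun c : ℝ => exists_isShearFlow_Ici hκ hq hB hC (α, b, c)
  have hcont : Continuous fun c => X c 0 := by simp only [hX0]; fun_prop
  have hacc : Continuous fun x : ℝ × ℝ × ℝ => x.2.2 - x.1 * slopeClamp l b x.2.1 := by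
    have := hκ.continuous
    fun_prop
  have hslope : Continuous fun x : ℝ × ℝ × ℝ => x.2.1 := by fun_prop
  have hU : IsOpen {c | ∃ T, 0 ≤ T ∧ 0 < shearAccel (slopeClamp l b) (X c) T ∧
      ∀ t ∈ Icc 0 T, l < (X c t).2.1} :=
    isOpen_setOf_exists_forall_Icc hκ hq hB hX hcont
      (isOpen_lt continuous_const hslope) (isOpen_lt continuous_const hacc)
  have hV : IsOpen {c | ∃ T, 0 ≤ T ∧ (X c T).2.1 < l ∧
      ∀ t ∈ Icc 0 T, shearAccel (slopeClamp l b) (X c) t < 0} :=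
    isOpen_setOf_exists_forall_Icc hκ hq hB hX hcont
      (isOpen_lt hacc continuous_const) (isOpen_lt hslope continuous_const)
  by_contra! hcon
  obtain ⟨c₁, hc₁⟩ := exists_forall_shearFlow_exits (κ := slopeClamp l b) hB hC α b l
  obtain ⟨c, -, ⟨T, hT, hzT, hyT⟩, ⟨T', hT', hyT', hzT'⟩⟩ := isPreconnected_univ _ _ hU hV
    (fun c _ => by
      rcases (hX c).stays_or_exits hκ hq hB hlb hgl hneg (by rw [hX0]) with h1 | h1
      · obtain ⟨t, ht, h2⟩ := hcon (X c) (hX c) (by rw [hX0]) (by rw [hX0])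
        exact absurd (h1 t ht).2 (not_lt.2 (h2 (h1 t ht).1))
      · exact h1)
    -- This parameter gives initial acceleration 1, an exit at time 0.
    ⟨α * slopeClamp l b b + 1, trivial, 0, le_rfl, by simp [shearAccel, hX0],
      fun t ht => by
        obtain rfl : t = 0 := le_antisymm ht.2 ht.1
        simpa [hX0] using hlb⟩
    ⟨c₁, trivial, 1, zero_le_one, hc₁ _ (hX c₁) (hX0 c₁)⟩
  -- The exits exclude each other: at the earlier of the two times the other exit's condition still
  -- holds.
  rcases le_total T T' with h1 | h1
  · exact absurd (hzT' T ⟨hT, h1⟩) (not_lt.2 hzT.le)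
  · exact absurd (hyT T' ⟨hT', h1⟩) (not_lt.2 hyT'.le)

end shooting

/-! ### Existence of a concave solution -/

theorem exists_isConcaveSolutionBVP {g : ℝ → ℝ} {α b l : ℝ} {K : NNReal}
    (hg : LipschitzOnWith K g (Icc l b)) (hl : 0 ≤ l) (hlb : l < b)
    (hneg : ∀ x ∈ Ioc l b, g x < 0) (hgl : g l = 0) :
    ∃ f : ℝ → ℝ, IsConcaveSolutionBVP g α b l f := by
  obtain ⟨K₂, hq⟩ := exists_lipschitzWith_clampedGrowth hg hl hlb
  obtain ⟨C, hC⟩ := exists_abs_clampedGrowth_le hg.continuousOn hl hlb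
  obtain ⟨X, hX, h0f, h0y, hstay⟩ := exists_shearFlow_stays lipschitzWith_slopeClamp hq
    (abs_slopeClamp_le hl hlb) hC hlb hgl hneg α
  set y := fun t => (X t).2.1 with hy
  set z := shearAccel (slopeClamp l b) X with hz
  have hanti : AntitoneOn y (Ici 0) :=
    antitoneOn_of_hasDerivWithinAt_subset (convex_Ici 0) subset_rfl
      (fun t ht => (hX t ht).shear_components.2.1) fun t ht => (hstay t ht).2.le
  have hyb : ∀ t, 0 ≤ t → y t ≤ b := fun t ht =>
    (hanti self_mem_Ici ht ht).trans h0y.le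
  have hf' : ∀ t ∈ Ici (0 : ℝ), HasDerivWithinAt (fun t => (X t).1) (y t) (Ici 0) t := by
    intro t ht
    have := (hX t ht).shear_components.1
    rwa [shearField, slopeClamp_eq ⟨(hstay t ht).1.le, (hyb t ht).trans (by linarith)⟩] at this
  have hy' : ∀ t ∈ Ici (0 : ℝ), HasDerivWithinAt y (z t) (Ici 0) t :=
    fun t ht => (hX t ht).shear_components.2.1
  have hz' : ∀ t ∈ Ici (0 : ℝ), HasDerivWithinAt z (-((X t).1 * z t) - g (y t)) (Ici 0) t :=
    fun t ht => hX.hasDerivWithinAt_accel ht (hstay t ht).1 (hyb t ht)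
  refine ⟨fun t => (X t).1, ⟨y, z, _, hf', hy', hz', fun t _ => by ring, h0f, h0y, ?_⟩, ?_⟩
  · refine tendsto_order.2 ⟨fun a ha => ?_, fun a ha => ?_⟩
    · filter_upwards [eventually_ge_atTop 0] with t ht using ha.trans (hstay t ht).1
    · obtain ⟨t₀, ht₀, hlt⟩ : ∃ t₀, 0 ≤ t₀ ∧ y t₀ < a := by
        by_contra! hge
        have ha0 : 0 < a := hl.trans_lt ha
        have hab : a ≤ b := (hge 0 le_rfl).trans (hyb 0 le_rfl)
        obtain ⟨x₀, hx₀, hmax⟩ := isCompact_Icc.exists_isMaxOn (nonempty_Icc.2 hab)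
          (hg.continuousOn.mono (Icc_subset_Icc_left ha.le))
        set m := -g x₀ with hm
        have hm0 : 0 < m := neg_pos.2 (hneg x₀ ⟨ha.trans_le hx₀.1, hx₀.2⟩)
        have hmono := monotoneOn_of_hasDerivWithinAt_subset (u := fun t => (X t).1 - a * t)
          (u' := fun t => y t - a) (convex_Ici 0) subset_rfl
          (fun t ht => by
            simpa using! (hf' t ht).sub ((hasDerivAt_id t).const_mul a).hasDerivWithinAt)
          (fun t ht => sub_nonneg.2 (hge t ht))
        -- From this time on f ≥ α + a t ≥ 0, so -f z ≥ 0 and z' ≥ m.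
        set t₁ := |α| / a with ht₁
        have ht₁0 : 0 ≤ t₁ := by positivity
        have hfpos : ∀ t, t₁ ≤ t → 0 ≤ (X t).1 := by
          intro t ht
          have h1 := hmono self_mem_Ici (ht₁0.trans ht) (ht₁0.trans ht)
          simp only [h0f, mul_zero, sub_zero] at h1
          have h2 : |α| ≤ a * t := by
            rw [ht₁, div_le_iff₀ ha0] at ht; linarith
          linarith [neg_abs_le α]
        have hmonoz := monotoneOn_of_hasDerivWithinAt_subset (u := fun t => z t - m * t)
          (u' := fun t => -((X t).1 * z t) - g (y t) - m) (convex_Ici t₁) (Ici_subset_Ici.2 ht₁0)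
          (fun t ht => by
            simpa using! (hz' t (ht₁0.trans ht)).sub
              ((hasDerivAt_id t).const_mul m).hasDerivWithinAt)
          (fun t ht => by
            have ht0 : 0 ≤ t := ht₁0.trans ht
            have h1 : g (y t) ≤ g x₀ := hmax ⟨hge t ht0, hyb t ht0⟩
            have h2 := mul_nonneg (hfpos t ht) (neg_nonneg.2 (hstay t ht0).2.le)
            linarith)
        -- The time at which the lower bound z(t₁) + m (t - t₁) reaches 0.
        set t₂ := t₁ + -z t₁ / m with ht₂
        have hle : t₁ ≤ t₂ := by
          have := div_nonneg (neg_nonneg.2 (hstay t₁ ht₁0).2.le) hm0.le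
          linarith
        have h1 := hmonoz self_mem_Ici hle hle
        have h2 : m * t₂ = m * t₁ - z t₁ := by
          rw [ht₂]; field_simp; ring
        have h3 := (hstay t₂ (ht₁0.trans hle)).2
        simp only [h2] at h1
        linarith
      filter_upwards [eventually_ge_atTop t₀] with t ht
      exact (hanti ht₀ (ht₀.trans ht) ht).trans_lt hlt
  · exact concaveOn_of_hasDerivWithinAt2_nonpos (convex_Ici 0)
      (fun t ht => (hf' t ht).continuousWithinAt)
      (fun t ht => (hf' t (interior_subset ht)).mono interior_subset)
      (fun t ht => (hy' t (interior_subset ht)).mono interior_subset)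
      (fun t ht => (hstay t (interior_subset ht)).2.le)

/-! ### Strict signs for an arbitrary concave solution -/

/-- The analytic content of a concave solution of the boundary value problem: slope and
acceleration, with their strict signs. -/
structure ConcaveProfile (g : ℝ → ℝ) (α b l : ℝ) (f f₁ f₂ : ℝ → ℝ) : Prop where
  deriv_zero : ∀ t ∈ Ici (0 : ℝ), HasDerivWithinAt f (f₁ t) (Ici 0) t
  deriv_one : ∀ t ∈ Ici (0 : ℝ), HasDerivWithinAt f₁ (f₂ t) (Ici 0) t
  deriv_two : ∀ t ∈ Ici (0 : ℝ), HasDerivWithinAt f₂ (-(f t * f₂ t) - g (f₁ t)) (Ici 0) t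
  value_zero : f 0 = α
  slope_zero : f₁ 0 = b
  tendsto_slope : Tendsto f₁ atTop (𝓝 l)
  slope_mem : ∀ t ∈ Ici (0 : ℝ), f₁ t ∈ Ioc l b
  accel_neg : ∀ t ∈ Ici (0 : ℝ), f₂ t < 0

theorem isShearFlow_of_solution {g : ℝ → ℝ} {b l : ℝ} {f f₁ f₂ : ℝ → ℝ}
    (h0 : ∀ t ∈ Ici (0 : ℝ), HasDerivWithinAt f (f₁ t) (Ici 0) t)
    (h1 : ∀ t ∈ Ici (0 : ℝ), HasDerivWithinAt f₁ (f₂ t) (Ici 0) t)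
    (h2 : ∀ t ∈ Ici (0 : ℝ), HasDerivWithinAt f₂ (-(f t * f₂ t) - g (f₁ t)) (Ici 0) t)
    (hmem : ∀ t ∈ Ici (0 : ℝ), f₁ t ∈ Icc l b) :
    IsShearFlow (slopeClamp l b) (clampedGrowth g l b)
      (fun t => (f t, f₁ t, f₂ t + f t * f₁ t)) (Ici 0) := by
  intro t ht
  convert! (h0 t ht).prodMk ((h1 t ht).prodMk ((h2 t ht).add ((h0 t ht).mul (h1 t ht)))) using 1
  have hm := hmem t ht
  simp only [shearField, clampedGrowth_eq hm, slopeClamp_eq ⟨hm.1, hm.2.trans (by linarith)⟩]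
  ext
  · rfl
  · simp
  · simp only []; ring

/-- Concavity gives f'' ≤ 0. A zero of f'' at slope above l would have f''' = -g > 0, making f''
positive just after; at slope l it is excluded by `IsShearFlow.accel_ne_zero`. -/
theorem IsConcaveSolutionBVP.exists_profile {g : ℝ → ℝ} {α b l : ℝ} {K : NNReal} {f : ℝ → ℝ}
    (hg : LipschitzOnWith K g (Icc l b)) (hl : 0 ≤ l) (hlb : l < b)
    (hneg : ∀ x ∈ Ioc l b, g x < 0) (hgl : g l = 0) (hf : IsConcaveSolutionBVP g α b l f) :
    ∃ f₁ f₂, ConcaveProfile g α b l f f₁ f₂ := by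
  obtain ⟨⟨f₁, f₂, f₃, h0, h1, h2, heq, hv, hs, hlim⟩, hconc⟩ := hf
  obtain ⟨K₂, hq⟩ := exists_lipschitzWith_clampedGrowth hg hl hlb
  have h2' : ∀ t ∈ Ici (0 : ℝ), HasDerivWithinAt f₂ (-(f t * f₂ t) - g (f₁ t)) (Ici 0) t := by
    intro t ht
    rw [show -(f t * f₂ t) - g (f₁ t) = f₃ t by linarith [heq t ht]]
    exact h2 t ht
  have hanti : AntitoneOn f₁ (Ici 0) :=
    (hconc.antitoneOn_derivWithin fun t ht => (h0 t ht).differentiableWithinAt).congr fun t ht =>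
      (h0 t ht).derivWithin (uniqueDiffOn_Ici 0 t ht)
  have hmem : ∀ t ∈ Ici (0 : ℝ), f₁ t ∈ Icc l b := by
    intro t ht
    refine ⟨le_of_tendsto hlim ?_, hs ▸ hanti self_mem_Ici ht ht⟩
    filter_upwards [eventually_ge_atTop t] with s hs using hanti ht (le_trans ht hs) hs
  have hnonpos : ∀ t ∈ Ici (0 : ℝ), f₂ t ≤ 0 := fun t ht => by
    rw [← (h1 t ht).derivWithin (uniqueDiffOn_Ici 0 t ht)]
    exact hanti.derivWithin_nonpos
  have hflow := isShearFlow_of_solution h0 h1 h2' hmem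
  have hacc : ∀ t ∈ Ici (0 : ℝ), f₂ t < 0 := by
    intro t ht
    refine lt_of_le_of_ne (hnonpos t ht) fun hz => ?_
    rcases eq_or_lt_of_le (hmem t ht).1 with hl' | hl'
    · refine hflow.accel_ne_zero lipschitzWith_slopeClamp hq (abs_slopeClamp_le hl hlb) hlb hgl hs
        ht hl'.symm ?_
      have hk : slopeClamp l b (f₁ t) = f₁ t :=
        slopeClamp_eq ⟨(hmem t ht).1, (hmem t ht).2.trans (by linarith)⟩
      simp only [shearAccel, hk, hz]
      ring
    · have hpos : 0 < -(f t * f₂ t) - g (f₁ t) := by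
        rw [hz]; linarith [hneg _ ⟨hl', (hmem t ht).2⟩]
      obtain ⟨s, hs1, hs2⟩ := ((((h2' t ht).mono (Ici_subset_Ici.2 ht)).eventually_lt_right
        hpos).and (self_mem_nhdsWithin : ∀ᶠ s in 𝓝[>] t, s ∈ Ioi t)).exists
      rw [hz] at hs1
      exact absurd (hnonpos s (le_trans ht (le_of_lt hs2))) (not_le.2 hs1)
  have hstrict : StrictAntiOn f₁ (Ici 0) :=
    strictAntiOn_of_hasDerivWithinAt_neg (convex_Ici 0) (fun t ht => (h1 t ht).continuousWithinAt)
      (fun t ht => (h1 t (interior_subset ht)).mono interior_subset)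
      (fun t ht => hacc t (interior_subset ht))
  refine ⟨f₁, f₂, h0, h1, h2', hv, hs, hlim, fun t ht => ⟨?_, (hmem t ht).2⟩, hacc⟩
  -- The slope is still at least l at t + 1 and decreases strictly, so it exceeds l at t.
  have ht1 : t + 1 ∈ Ici (0 : ℝ) := mem_Ici.2 (add_nonneg ht zero_le_one)
  exact (hmem _ ht1).1.trans_lt (hstrict ht ht1 (lt_add_one t))

/-! ### Crocco variables and comparison -/

/-- A profile described with the slope as independent variable: `F` is the value and `U` minus the
acceleration. -/
structure CroccoPair (g : ℝ → ℝ) (l b : ℝ) (F U : ℝ → ℝ) : Prop where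
  continuousOn_fst : ContinuousOn F (Ioc l b)
  continuousOn_snd : ContinuousOn U (Ioc l b)
  pos : ∀ x ∈ Ioc l b, 0 < U x
  deriv_fst : ∀ x ∈ Ioo l b, HasDerivAt F (-(x / U x)) x
  deriv_snd : ∀ x ∈ Ioo l b, HasDerivAt U (F x - g x / U x) x

/-- On an interval the continuous strictly monotone -u is an embedding, so v is continuous because
(-u) ∘ v = -id is. -/
theorem continuousOn_leftInverse_of_strictAntiOn {u v : ℝ → ℝ} {s t : Set ℝ} (hs : s.OrdConnected)
    (hu : StrictAntiOn u s) (hc : ContinuousOn u s) (hv : MapsTo v t s)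
    (huv : ∀ x ∈ t, u (v x) = x) : ContinuousOn v t := by
  have hmono : StrictMono fun x : s => -u x := fun x y hxy => neg_lt_neg (hu x.2 y.2 hxy)
  have hcont : Continuous fun x : s => -u x := (continuousOn_iff_continuous_domRestrict.1 hc).neg
  have : PreconnectedSpace s := Subtype.preconnectedSpace hs.isPreconnected
  have hemb := hmono.isEmbedding_of_ordConnected (isPreconnected_range hcont).ordConnected
  have hv' : Continuous (hv.restrict v t s) := by
    rw [hemb.continuous_iff]
    have : (fun x : s => -u x) ∘ hv.restrict v t s = fun x : t => -(x : ℝ) := by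
      ext x
      simp [huv x x.2]
    rw [this]
    fun_prop
  rw [continuousOn_iff_continuous_domRestrict]
  exact continuous_subtype_val.comp hv'

theorem ConcaveProfile.exists_croccoPair {g : ℝ → ℝ} {α b l : ℝ} {f f₁ f₂ : ℝ → ℝ}
    (h : ConcaveProfile g α b l f f₁ f₂) :
    ∃ F U, CroccoPair g l b F U ∧ F b = α ∧ U b = -f₂ 0 ∧ ∀ t ∈ Ici (0 : ℝ), U (f₁ t) = -f₂ t := by
  have hc : ContinuousOn f₁ (Ici 0) := fun t ht => (h.deriv_one t ht).continuousWithinAt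
  have hstrict : StrictAntiOn f₁ (Ici 0) :=
    strictAntiOn_of_hasDerivWithinAt_neg (convex_Ici 0) hc
      (fun t ht => (h.deriv_one t (interior_subset ht)).mono interior_subset)
      (fun t ht => h.accel_neg t (interior_subset ht))
  have hsurj : SurjOn f₁ (Ici 0) (Ioc l b) := by
    intro x hx
    obtain ⟨t, htx, ht⟩ := ((h.tendsto_slope.eventually (gt_mem_nhds hx.1)).and
      (eventually_ge_atTop 0)).exists
    obtain ⟨s, hs, rfl⟩ := intermediate_value_Icc' ht (hc.mono Icc_subset_Ici_self)
      ⟨htx.le, h.slope_zero.symm ▸ hx.2⟩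
    exact ⟨s, hs.1, rfl⟩
  set τ := Function.invFunOn f₁ (Ici 0) with hτ
  have hτmem : MapsTo τ (Ioc l b) (Ici 0) := hsurj.mapsTo_invFunOn
  have hτinv : ∀ x ∈ Ioc l b, f₁ (τ x) = x := hsurj.rightInvOn_invFunOn
  have hleft : ∀ t ∈ Ici (0 : ℝ), τ (f₁ t) = t := hstrict.injOn.leftInvOn_invFunOn
  have hτc : ContinuousOn τ (Ioc l b) :=
    continuousOn_leftInverse_of_strictAntiOn ordConnected_Ici hstrict hc hτmem hτinv
  have hτpos : ∀ x ∈ Ioo l b, 0 < τ x := by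
    intro x hx
    refine lt_of_le_of_ne (hτmem ⟨hx.1, hx.2.le⟩) fun e => hx.2.ne ?_
    rw [← hτinv x ⟨hx.1, hx.2.le⟩, ← e, h.slope_zero]
  have hτd : ∀ x ∈ Ioo l b, HasDerivAt τ (f₂ (τ x))⁻¹ x := by
    intro x hx
    have hx' : Ioc l b ∈ 𝓝 x := Ioc_mem_nhds hx.1 hx.2
    refine HasDerivAt.of_local_left_inverse (hτc.continuousAt hx')
      ((h.deriv_one _ (hτpos x hx).le).hasDerivAt (Ici_mem_nhds (hτpos x hx)))
      (h.accel_neg _ (hτpos x hx).le).ne ?_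
    filter_upwards [hx'] with y hy using hτinv y hy
  have hb : τ b = 0 := by simpa [h.slope_zero] using hleft 0 self_mem_Ici
  refine ⟨f ∘ τ, fun x => -f₂ (τ x), ⟨?_, ?_, ?_, ?_, ?_⟩, ?_, ?_, ?_⟩
  · exact ContinuousOn.comp (fun t ht => (h.deriv_zero t ht).continuousWithinAt) hτc hτmem
  · exact (ContinuousOn.comp (fun t ht => (h.deriv_two t ht).continuousWithinAt) hτc hτmem).neg
  · exact fun x hx => neg_pos.2 (h.accel_neg _ (hτmem hx))
  · intro x hx
    have hd := (h.deriv_zero _ (hτpos x hx).le).hasDerivAt (Ici_mem_nhds (hτpos x hx))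
    convert! hd.comp x (hτd x hx) using 1
    rw [hτinv x ⟨hx.1, hx.2.le⟩, div_neg, neg_neg, div_eq_mul_inv]
  · intro x hx
    have hd := (h.deriv_two _ (hτpos x hx).le).hasDerivAt (Ici_mem_nhds (hτpos x hx))
    convert! (hd.comp x (hτd x hx)).neg using 1
    have := (h.accel_neg _ (hτpos x hx).le).ne
    rw [hτinv x ⟨hx.1, hx.2.le⟩, Function.comp_apply]
    field_simp
    ring
  · simp [hb, h.value_zero]
  · simp [hb]
  · intro t ht
    simp [hleft t ht]

/-- While U₁ > U₂ to the left of b, x ≥ 0 gives F₁ ≤ F₂; with g < 0 both terms of (U₁ - U₂)' are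
then nonpositive, so the gap grows leftwards. -/
theorem CroccoPair.sub_le_sub {g : ℝ → ℝ} {l b : ℝ} {F₁ U₁ F₂ U₂ : ℝ → ℝ} (hl : 0 ≤ l)
    (hneg : ∀ x ∈ Ioc l b, g x < 0) (h₁ : CroccoPair g l b F₁ U₁) (h₂ : CroccoPair g l b F₂ U₂)
    (hF : F₁ b = F₂ b) (hU : U₂ b < U₁ b) :
    ∀ x ∈ Ioc l b, U₁ b - U₂ b ≤ U₁ x - U₂ x := by
  have hDc : ContinuousOn (fun x => U₁ x - U₂ x) (Ioc l b) :=
    h₁.continuousOn_snd.sub h₂.continuousOn_snd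
  have hEc : ContinuousOn (fun x => F₂ x - F₁ x) (Ioc l b) :=
    h₂.continuousOn_fst.sub h₁.continuousOn_fst
  have step : ∀ s ∈ Ioc l b, (∀ x ∈ Ioo s b, U₂ x < U₁ x) → U₁ b - U₂ b ≤ U₁ s - U₂ s := by
    intro s hs hlt
    have hsub : Icc s b ⊆ Ioc l b := fun x hx => ⟨hs.1.trans_le hx.1, hx.2⟩
    have hsub' : Ioo s b ⊆ Ioo l b := fun x hx => ⟨hs.1.trans hx.1, hx.2⟩
    have hinv : ∀ x ∈ Ioo s b, (U₁ x)⁻¹ ≤ (U₂ x)⁻¹ := fun x hx =>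
      inv_anti₀ (h₂.pos x (hsub (Ioo_subset_Icc_self hx))) (hlt x hx).le
    have hE : AntitoneOn (fun x => F₂ x - F₁ x) (Icc s b) := by
      refine antitoneOn_of_hasDerivWithinAt_nonpos (f' := fun x => -(x / U₂ x) - -(x / U₁ x))
        (convex_Icc s b) (hEc.mono hsub) (fun x hx => ?_) (fun x hx => ?_)
      all_goals rw [interior_Icc] at hx
      · exact ((h₂.deriv_fst x (hsub' hx)).sub (h₁.deriv_fst x (hsub' hx))).hasDerivWithinAt
      · have := mul_le_mul_of_nonneg_left (hinv x hx) (hl.trans (hsub' hx).1.le)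
        simp only [div_eq_mul_inv]
        linarith
    have hD : AntitoneOn (fun x => U₁ x - U₂ x) (Icc s b) := by
      refine antitoneOn_of_hasDerivWithinAt_nonpos
        (f' := fun x => (F₁ x - g x / U₁ x) - (F₂ x - g x / U₂ x))
        (convex_Icc s b) (hDc.mono hsub) (fun x hx => ?_) (fun x hx => ?_)
      all_goals rw [interior_Icc] at hx
      · exact ((h₁.deriv_snd x (hsub' hx)).sub (h₂.deriv_snd x (hsub' hx))).hasDerivWithinAt
      · have e1 := hE (Ioo_subset_Icc_self hx) (right_mem_Icc.2 hs.2) hx.2.le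
        have e2 := mul_le_mul_of_nonpos_left (hinv x hx)
          (hneg x (hsub (Ioo_subset_Icc_self hx))).le
        simp only [hF, sub_self] at e1
        simp only [div_eq_mul_inv]
        linarith
    exact hD (left_mem_Icc.2 hs.2) (right_mem_Icc.2 hs.2) hs.2
  intro x₀ hx₀
  refine step x₀ hx₀ fun x₁ hx₁ => ?_
  by_contra! hle
  have hsub : Icc x₁ b ⊆ Ioc l b := fun x hx => ⟨(hx₀.1.trans hx₁.1).trans_le hx.1, hx.2⟩
  -- At the rightmost point where U₁ ≤ U₂, `step` still gives the full positive gap, a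
  -- contradiction.
  set S := {x | x ∈ Icc x₁ b ∧ U₁ x - U₂ x ≤ 0}
  have hSc : IsClosed S :=
    (hDc.mono hsub).preimage_isClosed_of_isClosed isClosed_Icc isClosed_Iic
  have hSne : S.Nonempty := ⟨x₁, left_mem_Icc.2 hx₁.2.le, by linarith⟩
  have hSb : BddAbove S := ⟨b, fun x hx => hx.1.2⟩
  have hmem : sSup S ∈ S := hSc.csSup_mem hSne hSb
  have := step (sSup S) (hsub hmem.1) fun x hx => by
    by_contra! hle'
    exact absurd (le_csSup hSb (⟨⟨hmem.1.1.trans hx.1.le, hx.2.le⟩, by linarith⟩ : x ∈ S))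
      (not_le.2 hx.1)
  linarith [hmem.2]

/-- Otherwise the comparison keeps f'' ≤ -δ for all time, and the slope falls to l by time (b -
l)/δ. -/
theorem ConcaveProfile.accel_zero_le {g : ℝ → ℝ} {α b l : ℝ} {f f₁ f₂ h h₁ h₂ : ℝ → ℝ}
    (hl : 0 ≤ l) (hneg : ∀ x ∈ Ioc l b, g x < 0) (hf : ConcaveProfile g α b l f f₁ f₂)
    (hh : ConcaveProfile g α b l h h₁ h₂) : h₂ 0 ≤ f₂ 0 := by
  by_contra! hlt
  obtain ⟨F₁, U₁, hp, hF, hU, hUf⟩ := hf.exists_croccoPair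
  obtain ⟨F₂, U₂, hp', hF', hU', -⟩ := hh.exists_croccoPair
  set δ := h₂ 0 - f₂ 0 with hδ
  have hδ0 : 0 < δ := sub_pos.2 hlt
  have hacc : ∀ t ∈ Ici (0 : ℝ), f₂ t ≤ -δ := by
    intro t ht
    have h1 := hp.sub_le_sub hl hneg hp' (hF.trans hF'.symm) (by rw [hU, hU']; linarith) (f₁ t)
      (hf.slope_mem t ht)
    have h2 := hp'.pos _ (hf.slope_mem t ht)
    rw [hU, hU', hUf t ht] at h1
    linarith
  have hanti := antitoneOn_of_hasDerivWithinAt_subset (u := fun t => f₁ t + δ * t)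
    (u' := fun t => f₂ t + δ) (convex_Ici 0) subset_rfl
    (fun t ht => by
      simpa using! (hf.deriv_one t ht).add ((hasDerivAt_id t).const_mul δ).hasDerivWithinAt)
    (fun t ht => by linarith [hacc t ht])
  have hlb : l < b := hf.slope_zero ▸ (hf.slope_mem 0 self_mem_Ici).1
  have ht : (0 : ℝ) ≤ (b - l) / δ := div_nonneg (by linarith) hδ0.le
  have h1 := hanti self_mem_Ici ht ht
  simp only [hf.slope_zero, mul_div_cancel₀ _ hδ0.ne'] at h1
  linarith [(hf.slope_mem _ ht).1]

/-! ### Uniqueness and conclusion -/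

theorem IsConcaveSolutionBVP.eqOn {g : ℝ → ℝ} {α b l : ℝ} {K : NNReal} {f h : ℝ → ℝ}
    (hg : LipschitzOnWith K g (Icc l b)) (hl : 0 ≤ l) (hlb : l < b)
    (hneg : ∀ x ∈ Ioc l b, g x < 0) (hgl : g l = 0) (hf : IsConcaveSolutionBVP g α b l f)
    (hh : IsConcaveSolutionBVP g α b l h) : EqOn h f (Ici 0) := by
  obtain ⟨f₁, f₂, pf⟩ := hf.exists_profile hg hl hlb hneg hgl
  obtain ⟨h₁, h₂, ph⟩ := hh.exists_profile hg hl hlb hneg hgl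
  obtain ⟨K₂, hq⟩ := exists_lipschitzWith_clampedGrowth hg hl hlb
  have h0 : h₂ 0 = f₂ 0 :=
    le_antisymm (pf.accel_zero_le hl hneg ph) (ph.accel_zero_le hl hneg pf)
  have flow_f := isShearFlow_of_solution pf.deriv_zero pf.deriv_one pf.deriv_two
    fun t ht => Ioc_subset_Icc_self (pf.slope_mem t ht)
  have flow_h := isShearFlow_of_solution ph.deriv_zero ph.deriv_one ph.deriv_two
    fun t ht => Ioc_subset_Icc_self (ph.slope_mem t ht)
  intro t ht
  have hsub : Icc 0 t ⊆ Ici 0 := Icc_subset_Ici_self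
  have := (flow_h.mono hsub).eqOn lipschitzWith_slopeClamp hq
    (abs_slopeClamp_le hl hlb) (flow_f.mono hsub)
    (by simp [pf.value_zero, pf.slope_zero, ph.value_zero, ph.slope_zero, h0])
    (right_mem_Icc.2 ht)
  exact congrArg Prod.fst this

theorem mainTheorem1 (g : ℝ → ℝ) (J : Set ℝ) (α β l : ℝ)
    (hJ : J.OrdConnected) (hlJ : l ∈ J) (hβJ : β ∈ J) (hg : LocallyLipschitzOn J g)
    (hl : 0 ≤ l) (hlβ : l < β)
    (hneg : ∀ x ∈ Ioc l β, g x < 0) (hgl : g l = 0) :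
    ∃ f : ℝ → ℝ, IsConcaveSolutionBVP g α β l f ∧
      ∀ h : ℝ → ℝ, IsConcaveSolutionBVP g α β l h → EqOn h f (Ici 0) := by
  obtain ⟨K, hK⟩ := (hg.mono (hJ.out hlJ hβJ)).exists_lipschitzOnWith_of_compact isCompact_Icc
  obtain ⟨f, hf⟩ := exists_isConcaveSolutionBVP (α := α) hK hl hlβ hneg hgl
  exact ⟨f, hf, fun h hh => hf.eqOn hK hl hlβ hneg hgl hh⟩
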